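/- Let $X$ be a (real or complex) Banach space with dual $X'$. A norm bounded set $A\subset X$ is a Dunford-Pettis (DP) set if every weakly null sequence $(f_n)$ in $X'$ satisfies $\lim_n\sup_{x\in A}|f_n(x)|=0$. A norm bounded set $A\subset X'$ is an L-Dunford-Pettis set if $\lim_n\sup_{f\in A}|f(x_n)|=0$ for every weakly null sequence $(x_n)$ in $X$ whose set of terms is a DP set. The space $X$ has the L-Dunford-Pettis property if every L-Dunford-Pettis set in $X'$ is relatively weakly compact, i.e. relatively compact for $\sigma(X',X'')$. Let $L(X,\ell^\infty)$ be the space of bounded linear operators from $X$ to $\ell^\infty$ with the operator norm; let $W(X,\ell^\infty)$ be its subspace of weakly compact operators (those mapping the closed unit ball of $X$ to a relatively weakly compact set), and $DPcc(X,\ell^\infty)$ its subspace of Dunford-Pettis completely continuous operators, i.e. those $T$ with $\|Tx_n\|\to 0$ for every weakly null sequence $(x_n)$ in $X$ whose set of terms is a DP set. Then the following assertions are equivalent: 1. $X$ has the L-Dunford-Pettis property; 2. $W(X,\ell^\infty)=DPcc(X,\ell^\infty)$; 3. $W(X,\ell^\infty)$ is complemented in $DPcc(X,\ell^\infty)$,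 i.e. $W(X,\ell^\infty)\subset DPcc(X,\ell^\infty)$ and there is a bounded linear projection of $DPcc(X,\ell^\infty)$ onto $W(X,\ell^\infty)$. -/

import Mathlib

open Filter Topology
open scoped ENNReal

noncomputable section

namespace LDP

section Sets

variable (𝕜 : Type*) [RCLike 𝕜] {E : Type*} [NormedAddCommGroup E] [NormedSpace 𝕜 E]

/-- A sequence that converges to `0` in the weak topology `σ(E, E')`. -/
def WeaklyNull (x : ℕ → E) : Prop :=
  Tendsto (fun n => toWeakSpace 𝕜 E (x n)) atTop (𝓝 0)

/-- A set whose closure in the weak topology `σ(E, E')` is weakly compact. -/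
def RelWeaklyCompact (A : Set E) : Prop :=
  IsCompact (closure (toWeakSpace 𝕜 E '' A))

/-- Dunford-Pettis set: a norm bounded set on which every weakly null sequence of the dual
(weakly null for `σ(E', E'')`) converges uniformly to zero. -/
def IsDPSet (A : Set E) : Prop :=
  Bornology.IsBounded A ∧
    ∀ f : ℕ → StrongDual 𝕜 E, WeaklyNull 𝕜 f →
      TendstoUniformlyOn (fun n (x : E) => f n x) (fun _ => 0) atTop A

/-- L-Dunford-Pettis set: a norm bounded set of functionals on which every weakly null sequence of
`E` whose range is a Dunford-Pettis set converges uniformly to zero. -/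
def IsLDPSet (A : Set (StrongDual 𝕜 E)) : Prop :=
  Bornology.IsBounded A ∧
    ∀ x : ℕ → E, WeaklyNull 𝕜 x → IsDPSet 𝕜 (Set.range x) →
      TendstoUniformlyOn (fun n (f : StrongDual 𝕜 E) => f (x n)) (fun _ => 0) atTop A

variable (E) in
/-- The L-Dunford-Pettis property: L-Dunford-Pettis sets of the dual are relatively compact for
the weak topology `σ(E', E'')`. -/
def HasLDPProperty : Prop :=
  ∀ A : Set (StrongDual 𝕜 E), IsLDPSet 𝕜 A → RelWeaklyCompact 𝕜 A

end Sets

section Operators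

variable {𝕜 : Type*} [RCLike 𝕜]
  {E : Type*} [NormedAddCommGroup E] [NormedSpace 𝕜 E]
  {F : Type*} [NormedAddCommGroup F] [NormedSpace 𝕜 F]

/-- Dunford-Pettis completely continuous operator. -/
def IsDPcc (T : E →L[𝕜] F) : Prop :=
  ∀ x : ℕ → E, WeaklyNull 𝕜 x → IsDPSet 𝕜 (Set.range x) →
    Tendsto (fun n => T (x n)) atTop (𝓝 0)

/-- Weakly compact operator. -/
def IsWeaklyCompactOp (T : E →L[𝕜] F) : Prop :=
  RelWeaklyCompact 𝕜 (T '' Metric.closedBall 0 1)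

theorem isWeaklyCompactOp_of_subset {T : E →L[𝕜] F} {K : Set (WeakSpace 𝕜 F)} (hK : IsCompact K)
    (h : ∀ x ∈ Metric.closedBall (0 : E) 1, toWeakSpace 𝕜 F (T x) ∈ K) :
    IsWeaklyCompactOp T := by
  refine hK.closure_of_subset ?_
  rintro _ ⟨_, ⟨x, hx, rfl⟩, rfl⟩
  exact h x hx

theorem IsWeaklyCompactOp.mem {T : E →L[𝕜] F} {x : E} (hx : x ∈ Metric.closedBall (0 : E) 1) :
    toWeakSpace 𝕜 F (T x) ∈ closure (toWeakSpace 𝕜 F '' (T '' Metric.closedBall 0 1)) :=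
  subset_closure ⟨_, ⟨x, hx, rfl⟩, rfl⟩

variable (𝕜 E F)

/-- The space of weakly compact operators, inside `E →L[𝕜] F` with the operator norm. -/
def W : Submodule 𝕜 (E →L[𝕜] F) where
  carrier := {T | IsWeaklyCompactOp T}
  zero_mem' := isWeaklyCompactOp_of_subset (isCompact_singleton (x := 0)) (by simp)
  add_mem' {S T} hS hT :=
    isWeaklyCompactOp_of_subset ((IsCompact.prod hS hT).image continuous_add) fun _ hx =>
      ⟨(_, _), ⟨IsWeaklyCompactOp.mem hx, IsWeaklyCompactOp.mem hx⟩, by simp⟩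
  smul_mem' c T hT :=
    isWeaklyCompactOp_of_subset (IsCompact.image hT (continuous_const_smul c)) fun _ hx =>
      ⟨_, IsWeaklyCompactOp.mem hx, by simp⟩

/-- The space of Dunford-Pettis completely continuous operators, inside `E →L[𝕜] F` with the
operator norm. -/
def DPcc : Submodule 𝕜 (E →L[𝕜] F) where
  carrier := {T | IsDPcc T}
  zero_mem' := fun x _ _ => by simp
  add_mem' {S T} hS hT := fun x h h' => by simpa using (hS x h h').add (hT x h h')
  smul_mem' c T hT := fun x h h' => by simpa using (hT x h h').const_smul c

end Operators

/-- `p` is a complemented subspace of `q`: it is contained in `q`, and there is a bounded linear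
projection of `q` onto `p`. -/
def ComplementedIn {𝕜 : Type*} [RCLike 𝕜] {E : Type*} [NormedAddCommGroup E] [NormedSpace 𝕜 E]
    (p q : Submodule 𝕜 E) : Prop :=
  p ≤ q ∧ (p.submoduleOf q).ClosedComplemented

/-- The Banach space of bounded scalar sequences with the supremum norm. -/
abbrev EllInfty (𝕜 : Type*) [RCLike 𝕜] : Type _ := lp (fun _ : ℕ => 𝕜) ∞

end LDP

end

/-! Weak compactness is tested throughout by Grothendieck's double limit condition, which is
symmetric in its two arguments and so passes between an operator and its adjoint (Gantmacher). For
an operator `T`, the supremum of `|f x|` over `adjointBall T` is `‖T x‖`. Hence `T` is DPcc exactly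
when that set is L-Dunford-Pettis, and it is weakly compact exactly when that set is relatively
weakly compact. This gives 1 → 2, and 2 → 3 is trivial. For 3 → 1, a sequence `f` in an
L-Dunford-Pettis set defines a DPcc operator `T x = (f n x)ₙ`. A projection `P` onto `W` fixes the
multiples `b * T` with `b` a unit vector, so `b ↦ b * T - P (b * T)` kills finitely supported `b`.
As in Phillips' lemma, an uncountable almost disjoint family yields an infinite `M` on whose
indicator countably many coordinates of this map vanish. There the weakly compact `P (1_M * T)`
agrees with `T`, so the double limits of `f n (x m)` coincide. -/

namespace LDP

/-! ### Grothendieck's double limit condition -/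

section IteratedLimits

variable {𝕜 : Type*} [RCLike 𝕜]

/-- Grothendieck's interchangeable double limit condition: whenever both iterated limits of
`p (a n) (b m)` exist, for sequences in `A` and `B`, they are equal. -/
def IteratedLimitsAgree {α β : Type*} (A : Set α) (B : Set β) (p : α → β → 𝕜) : Prop :=
  ∀ (a : ℕ → α) (b : ℕ → β), (∀ n, a n ∈ A) → (∀ m, b m ∈ B) →
    ∀ (u v : ℕ → 𝕜) (r s : 𝕜),
      (∀ n, Tendsto (fun m => p (a n) (b m)) atTop (𝓝 (u n))) → Tendsto u atTop (𝓝 r) →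
      (∀ m, Tendsto (fun n => p (a n) (b m)) atTop (𝓝 (v m))) → Tendsto v atTop (𝓝 s) → r = s

theorem IteratedLimitsAgree.flip {α β : Type*} {A : Set α} {B : Set β} {p : α → β → 𝕜}
    (h : IteratedLimitsAgree A B p) : IteratedLimitsAgree B A fun b a => p a b :=
  fun b a hb ha u v r s hu hr hv hs => (h a b ha hb v u s r hv hs hu hr).symm

theorem iteratedLimitsAgree_image_iff {α β γ : Type*} {A : Set α} {B : Set β} {j : α → γ}
    {p : γ → β → 𝕜} :
    IteratedLimitsAgree (j '' A) B p ↔ IteratedLimitsAgree A B fun a b => p (j a) b := by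
  constructor
  · intro h a b ha hb
    exact h (fun n => j (a n)) b (fun n => ⟨a n, ha n, rfl⟩) hb
  · intro h a b ha hb
    choose a' ha' hj using ha
    obtain rfl : (fun n => j (a' n)) = a := funext hj
    exact h a' b ha' hb

theorem _root_.MapClusterPt.eq_of_tendsto {α Y : Type*} [TopologicalSpace Y] [T2Space Y]
    {l : Filter α} {u : α → Y} {x y : Y} (hx : MapClusterPt x l u) (hy : Tendsto u l (𝓝 y)) :
    x = y :=
  haveI : NeBot (𝓝 x ⊓ 𝓝 y) := ClusterPt.mono hx hy
  eq_of_nhds_neBot this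

end IteratedLimits

/-! ### Weak compactness: double limit criteria and Eberlein–Šmulian -/

section WeakCompactness

variable {𝕜 : Type*} [RCLike 𝕜] {E : Type*} [NormedAddCommGroup E] [NormedSpace 𝕜 E]

theorem continuous_eval_weakSpace (f : StrongDual 𝕜 E) :
    Continuous fun x : WeakSpace 𝕜 E => f ((toWeakSpace 𝕜 E).symm x) :=
  WeakBilin.eval_continuous (topDualPairing 𝕜 E).flip f

theorem weaklyNull_iff {x : ℕ → E} :
    WeaklyNull 𝕜 x ↔ ∀ f : StrongDual 𝕜 E, Tendsto (fun n => f (x n)) atTop (𝓝 0) := by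
  refine ⟨fun h f => ?_, fun h => ?_⟩
  · simpa [Function.comp_def] using ((continuous_eval_weakSpace f).tendsto _).comp h
  · refine (WeakBilin.tendsto_iff_forall_eval_tendsto (B := (topDualPairing 𝕜 E).flip) ?_).2
      fun f => ?_
    · exact fun x y hxy => (SeparatingDual.eq_iff_forall_dual_eq (R := 𝕜)).2 fun g =>
        DFunLike.congr_fun hxy g
    · exact (map_zero f) ▸ h f

theorem RelWeaklyCompact.mono {A B : Set E} (hB : RelWeaklyCompact 𝕜 B) (h : A ⊆ B) :
    RelWeaklyCompact 𝕜 A :=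
  IsCompact.of_isClosed_subset hB isClosed_closure (closure_mono (Set.image_mono h))

/-- A relatively weakly compact set and the dual ball have interchangeable double limits. -/
theorem RelWeaklyCompact.iteratedLimitsAgree {A : Set E} (hA : RelWeaklyCompact 𝕜 A) :
    IteratedLimitsAgree A (Metric.closedBall (0 : StrongDual 𝕜 E) 1) fun x f => f x := by
  intro a b ha hb u v r s hu hr hv hs
  obtain ⟨a₀, -, ha₀⟩ := IsCompact.exists_mapClusterPt hA (f := atTop)
    (u := fun n => toWeakSpace 𝕜 E (a n))
    (tendsto_principal.2 (Eventually.of_forall fun n => subset_closure ⟨_, ha n, rfl⟩))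
  obtain ⟨b₀, -, hb₀⟩ := (WeakDual.isCompact_closedBall (0 : StrongDual 𝕜 E) 1).exists_mapClusterPt
    (f := atTop) (u := fun n => StrongDual.toWeakDual (b n))
    (tendsto_principal.2 (Eventually.of_forall fun n => hb n))
  have ha' (f : StrongDual 𝕜 E) :
      MapClusterPt (f ((toWeakSpace 𝕜 E).symm a₀)) atTop fun n => f (a n) :=
    MapClusterPt.continuousAt_comp (X := WeakSpace 𝕜 E)
      (continuous_eval_weakSpace f).continuousAt ha₀
  have hb' (x : E) : MapClusterPt (b₀ x) atTop fun n => b n x :=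
    hb₀.continuousAt_comp (WeakDual.eval_continuous x).continuousAt
  have hu' : u = fun n => b₀ (a n) := funext fun n => ((hb' _).eq_of_tendsto (hu n)).symm
  have hv' : v = fun m => b m ((toWeakSpace 𝕜 E).symm a₀) :=
    funext fun m => ((ha' _).eq_of_tendsto (hv m)).symm
  rw [hu'] at hr
  rw [hv'] at hs
  exact ((ha' (WeakDual.toStrongDual b₀)).eq_of_tendsto hr).symm.trans ((hb' _).eq_of_tendsto hs)

theorem norm_le_of_forall_re_le {f : StrongDual 𝕜 E} {C : ℝ}
    (h : ∀ x ∈ Metric.closedBall (0 : E) 1, RCLike.re (f x) ≤ C) : ‖f‖ ≤ C := by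
  have hC : 0 ≤ C := by simpa using h 0 (by simp)
  refine f.opNorm_le_bound hC fun x => ?_
  rcases eq_or_ne x 0 with rfl | hx
  · simp
  obtain ⟨c, hc, hcf⟩ := RCLike.exists_norm_eq_mul_self (f x)
  have hx' : 0 < ‖x‖ := norm_pos_iff.2 hx
  have key := h ((c * ((‖x‖⁻¹ : ℝ) : 𝕜)) • x) (by simp [norm_smul, hc, hx'.ne'])
  have hval : f ((c * ((‖x‖⁻¹ : ℝ) : 𝕜)) • x) = ((‖x‖⁻¹ * ‖f x‖ : ℝ) : 𝕜) := by
    rw [map_smul, smul_eq_mul, RCLike.ofReal_mul, hcf]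
    ring
  rw [hval, RCLike.ofReal_re, inv_mul_le_iff₀ hx'] at key
  linarith

/-- Finite form of Goldstine's theorem. -/
theorem exists_mem_closedBall_forall_norm_sub_lt {φ : StrongDual 𝕜 (StrongDual 𝕜 E)}
    (hφ : ‖φ‖ ≤ 1) {ι : Type*} [Finite ι] (f : ι → StrongDual 𝕜 E) {ε : ℝ} (hε : 0 < ε) :
    ∃ x ∈ Metric.closedBall (0 : E) 1, ∀ i, ‖f i x - φ (f i)‖ < ε := by
  classical
  have := Fintype.ofFinite ι
  let : NormedSpace ℝ E := NormedSpace.restrictScalars ℝ 𝕜 E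
  have : IsScalarTower ℝ 𝕜 E := IsScalarTower.restrictScalars ..
  let L : E →L[𝕜] ι → 𝕜 := ContinuousLinearMap.pi f
  let C : Set (ι → 𝕜) := L '' Metric.closedBall (0 : E) 1
  have hC : Convex ℝ C :=
    (convex_closedBall (0 : E) 1).is_linear_image
      ((L.toLinearMap.restrictScalars ℝ).isLinear)
  have hmem : (fun i => φ (f i)) ∈ closure C := by
    by_contra hn
    obtain ⟨l, s, hs, hl⟩ :=
      RCLike.geometric_hahn_banach_closed_point (𝕜 := 𝕜) hC.closure isClosed_closure hn
    have hl' (z : ι → 𝕜) : l z = ∑ i, l (Pi.single i 1) * z i := by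
      conv_lhs => rw [pi_eq_sum_univ' z]
      simp [map_sum, mul_comm, Pi.single]
    have hg : ‖∑ i, l (Pi.single i 1) • f i‖ ≤ s := by
      refine norm_le_of_forall_re_le fun x hx => ?_
      have := (hs _ (subset_closure ⟨x, hx, rfl⟩)).le
      rw [hl'] at this
      simpa [L] using this
    rw [hl'] at hl
    have h2 : RCLike.re (φ (∑ i, l (Pi.single i 1) • f i)) ≤ s :=
      (RCLike.re_le_norm _).trans ((φ.le_of_opNorm_le hφ _).trans (by simpa using hg))
    simp only [map_sum, map_smul, smul_eq_mul] at h2 hl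
    exact absurd hl (not_lt.2 h2)
  obtain ⟨_, ⟨x, hx, rfl⟩, hd⟩ := Metric.mem_closure_iff.1 hmem ε hε
  refine ⟨x, hx, fun i => ?_⟩
  rw [← dist_eq_norm, dist_comm]
  exact (dist_le_pi_dist _ _ i).trans_lt hd

/-- A functional in the weak-star closure, in the third dual, of a set `A` of functionals having
interchangeable double limits with the unit ball comes from the dual. -/
theorem IteratedLimitsAgree.apply_eq_of_mem_closure {A : Set (StrongDual 𝕜 E)}
    (h : IteratedLimitsAgree A (Metric.closedBall (0 : E) 1) fun f x => f x)
    {z : WeakDual 𝕜 (StrongDual 𝕜 (StrongDual 𝕜 E))}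
    (hz : z ∈ closure (NormedSpace.inclusionInDoubleDualWeak 𝕜 (StrongDual 𝕜 E) ''
      (toWeakSpace 𝕜 (StrongDual 𝕜 E) '' A)))
    {φ : StrongDual 𝕜 (StrongDual 𝕜 E)} (hφ : ‖φ‖ ≤ 1) :
    z φ = φ ((WeakDual.toStrongDual z).comp (NormedSpace.inclusionInDoubleDual 𝕜 E)) := by
  set f : StrongDual 𝕜 E :=
    (WeakDual.toStrongDual z).comp (NormedSpace.inclusionInDoubleDual 𝕜 E) with hf
  let e : ℕ → ℝ := fun n => 1 / ((n : ℝ) + 1)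
  have he (n) : 0 < e n := Nat.one_div_pos_of_nat
  -- Recursive choice of pairs `(a, x)`: Goldstine picks `x` close to `φ` on `f` and on all earlier
  -- `a`, and the weak-star closure picks `a` close to `z` at `φ` and at all earlier `x`. The two
  -- iterated limits of `a n (x m)` are then `z φ` and `φ f`.
  obtain ⟨g, hP, hr⟩ := exists_seq_of_forall_finset_exists (α := ℕ × StrongDual 𝕜 E × E)
    (fun p => p.2.1 ∈ A ∧ p.2.2 ∈ Metric.closedBall (0 : E) 1 ∧ ‖f p.2.2 - φ f‖ < e p.1 ∧
      ‖φ p.2.1 - z φ‖ < e p.1)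
    (fun p q => p.1 < q.1 ∧ ‖p.2.1 q.2.2 - φ p.2.1‖ < e q.1 ∧
      ‖q.2.1 p.2.2 - f p.2.2‖ < e q.1) (by
    intro s _
    obtain ⟨N, hN⟩ : ∃ N : ℕ, ∀ p ∈ s, p.1 < N :=
      ⟨s.sup Prod.fst + 1, fun p hp => Nat.lt_succ_of_le (Finset.le_sup (f := Prod.fst) hp)⟩
    obtain ⟨x, hx, hxs⟩ := exists_mem_closedBall_forall_norm_sub_lt hφ
      (fun i : Option s => i.elim f fun p => p.1.2.1) (he N)
    have hev (ψ : StrongDual 𝕜 (StrongDual 𝕜 E)) : ∀ᶠ y in 𝓝 z, ‖y ψ - z ψ‖ < e N := by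
      have := (WeakDual.eval_continuous ψ).tendsto z
      filter_upwards [this (Metric.ball_mem_nhds _ (he N))] with y hy
      simpa [dist_eq_norm] using hy
    have hev' := (hev φ).and ((Finset.eventually_all s).2 fun p _ =>
      hev (NormedSpace.inclusionInDoubleDual 𝕜 E p.2.2))
    obtain ⟨_, ⟨hy, hys⟩, _, ⟨a, ha, rfl⟩, rfl⟩ := mem_closure_iff_nhds.1 hz _ hev'
    exact ⟨(N, a, x), ⟨ha, hx, hxs none, hy⟩, fun p hp =>
      ⟨hN p hp, hxs (some ⟨p, hp⟩), hys p hp⟩⟩)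
  have hmono : StrictMono fun n => (g n).1 := fun m n hmn => (hr m n hmn).1
  have hlim : Tendsto (fun n => e (g n).1) atTop (𝓝 0) :=
    tendsto_one_div_add_atTop_nhds_zero_nat.comp hmono.tendsto_atTop
  have key {w : ℕ → 𝕜} {c : 𝕜} (N : ℕ) (hw : ∀ n, N < n → ‖w n - c‖ < e (g n).1) :
      Tendsto w atTop (𝓝 c) :=
    tendsto_iff_norm_sub_tendsto_zero.2 (squeeze_zero' (.of_forall fun _ => norm_nonneg _)
      ((eventually_gt_atTop N).mono fun n hn => (hw n hn).le) hlim)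
  exact h (fun n => (g n).2.1) (fun n => (g n).2.2) (fun n => (hP n).1) (fun n => (hP n).2.1)
    (fun n => φ (g n).2.1) (fun n => f (g n).2.2) _ _
    (fun n => key n fun m hm => (hr n m hm).2.1) (key 0 fun n _ => (hP n).2.2.2)
    (fun m => key m fun n hn => (hr m n hn).2.2) (key 0 fun n _ => (hP n).2.2.1)

/-- A bounded set of functionals having interchangeable double limits with the unit ball is
relatively weakly compact. -/
theorem IteratedLimitsAgree.relWeaklyCompact_dual {A : Set (StrongDual 𝕜 E)}
    (h : IteratedLimitsAgree A (Metric.closedBall (0 : E) 1) fun f x => f x)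
    (hA : Bornology.IsBounded A) : RelWeaklyCompact 𝕜 A := by
  refine NormedSpace.isCompact_closure_of_isBounded 𝕜 _ _ ?_ fun z hz => ?_
  · rwa [Set.preimage_image_eq _ (toWeakSpace 𝕜 _).injective]
  · refine ⟨toWeakSpace 𝕜 _
      ((WeakDual.toStrongDual z).comp (NormedSpace.inclusionInDoubleDual 𝕜 E)), ?_⟩
    refine DFunLike.ext _ _ fun φ => ?_
    obtain ⟨c, hc, hc'⟩ : ∃ c : 𝕜, c ≠ 0 ∧ ‖c • φ‖ ≤ 1 := by
      refine ⟨((‖φ‖ + 1 : ℝ) : 𝕜)⁻¹, ?_, ?_⟩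
      · have : ‖φ‖ + 1 ≠ 0 := by positivity
        exact inv_ne_zero (by exact_mod_cast this)
      · rw [norm_smul, norm_inv, RCLike.norm_ofReal, abs_of_nonneg (by positivity),
          inv_mul_le_one₀ (by positivity)]
        linarith
    have := h.apply_eq_of_mem_closure hz hc'
    have h2 : c * z φ = c * φ ((WeakDual.toStrongDual z).comp
        (NormedSpace.inclusionInDoubleDual 𝕜 E)) := by simpa using this
    exact (mul_left_cancel₀ hc h2).symm

theorem isClosed_image_toWeakSpace_submodule {p : Submodule 𝕜 E} (hp : IsClosed (p : Set E)) :
    IsClosed (toWeakSpace 𝕜 E '' (p : Set E)) := by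
  let : NormedSpace ℝ E := NormedSpace.restrictScalars ℝ 𝕜 E
  have : IsScalarTower ℝ 𝕜 E := IsScalarTower.restrictScalars ..
  have hconv : Convex ℝ (p : Set E) := (p.restrictScalars ℝ).convex
  rw [← closure_eq_iff_isClosed, ← hconv.toWeakSpace_closure 𝕜, hp.closure_eq]

variable {F : Type*} [NormedAddCommGroup F] [NormedSpace 𝕜 F]

theorem _root_.LinearIsometry.exists_comp_eq (J : E →ₗᵢ[𝕜] F) (f : StrongDual 𝕜 E) :
    ∃ g : StrongDual 𝕜 F, ∀ x, g (J x) = f x := by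
  obtain ⟨g, hg, -⟩ := exists_extension_norm_eq (LinearMap.range J.toLinearMap)
    (f.comp (J.equivRange.symm.toContinuousLinearEquiv : _ →L[𝕜] E))
  refine ⟨g, fun x => (hg (J.equivRange x)).trans ?_⟩
  simp

/-- By Hahn–Banach every functional on `E` factors through `J`, so the weak topology of `E` is
induced from that of `F`. -/
theorem isEmbedding_weakSpace_map (J : E →ₗᵢ[𝕜] F) :
    IsEmbedding (WeakSpace.map J.toContinuousLinearMap) := by
  choose e he using J.exists_comp_eq
  have hev : Continuous fun (y : WeakSpace 𝕜 F) (f : StrongDual 𝕜 E) =>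
      e f ((toWeakSpace 𝕜 F).symm y) := continuous_pi fun f => continuous_eval_weakSpace (e f)
  refine ⟨IsInducing.of_comp (WeakSpace.map J.toContinuousLinearMap).continuous hev ?_,
    J.injective⟩
  have : (fun (y : WeakSpace 𝕜 F) (f : StrongDual 𝕜 E) => e f ((toWeakSpace 𝕜 F).symm y)) ∘
      WeakSpace.map J.toContinuousLinearMap =
        fun (x : WeakSpace 𝕜 E) f => (topDualPairing 𝕜 E).flip x f := by
    funext x f
    exact he f x
  rw [this]
  exact ⟨rfl⟩

/-- Completeness makes the range of `J` norm closed, hence weakly closed by Mazur, so the weak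
closure of `J '' A` stays in the range. -/
theorem relWeaklyCompact_of_image [CompleteSpace E] (J : E →ₗᵢ[𝕜] F) {A : Set E}
    (hA : RelWeaklyCompact 𝕜 (J '' A)) : RelWeaklyCompact 𝕜 A := by
  have hm := isEmbedding_weakSpace_map J
  have hcl : IsClosed (LinearMap.range J.toLinearMap : Set F) :=
    J.isometry.isUniformInducing.isComplete_range.isClosed
  have himg : WeakSpace.map J.toContinuousLinearMap '' (toWeakSpace 𝕜 E '' A) =
      toWeakSpace 𝕜 F '' (J '' A) := by
    simp only [Set.image_image]; rfl
  unfold RelWeaklyCompact at hA ⊢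
  rw [hm.closure_eq_preimage_closure_image, himg]
  refine hm.isCompact_preimage' hA ?_
  refine (closure_minimal ?_ (isClosed_image_toWeakSpace_submodule hcl)).trans ?_
  · rintro _ ⟨_, ⟨x, -, rfl⟩, rfl⟩
    exact ⟨_, ⟨x, rfl⟩, rfl⟩
  · rintro _ ⟨_, ⟨x, rfl⟩, rfl⟩
    exact ⟨toWeakSpace 𝕜 E x, rfl⟩

/-- A bounded subset of a Banach space having interchangeable double limits with the dual ball is
relatively weakly compact. -/
theorem IteratedLimitsAgree.relWeaklyCompact [CompleteSpace E] {A : Set E}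
    (h : IteratedLimitsAgree A (Metric.closedBall (0 : StrongDual 𝕜 E) 1) fun x f => f x)
    (hA : Bornology.IsBounded A) : RelWeaklyCompact 𝕜 A := by
  have himg : RelWeaklyCompact 𝕜 (NormedSpace.inclusionInDoubleDualLi (E := E) 𝕜 '' A) :=
    IteratedLimitsAgree.relWeaklyCompact_dual (iteratedLimitsAgree_image_iff.2 h)
      ((NormedSpace.inclusionInDoubleDualLi (E := E) 𝕜).lipschitz.isBounded_image hA)
  exact relWeaklyCompact_of_image _ himg

/-- **Eberlein–Šmulian theorem**, sequential compactness of relatively weakly compact sets. -/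
theorem RelWeaklyCompact.exists_subseq_weaklyNull {A : Set E} (hA : RelWeaklyCompact 𝕜 A)
    {x : ℕ → E} (hx : ∀ n, x n ∈ A) :
    ∃ (x₀ : E) (σ : ℕ → ℕ), StrictMono σ ∧ WeaklyNull 𝕜 fun n => x (σ n) - x₀ := by
  have hK : RelWeaklyCompact 𝕜 (Set.range x) := hA.mono (Set.range_subset_iff.2 hx)
  set K := closure (toWeakSpace 𝕜 E '' Set.range x) with hKdef
  let S : Submodule 𝕜 E := (Submodule.span 𝕜 (Set.range x)).topologicalClosure
  have hKS : K ⊆ toWeakSpace 𝕜 E '' (S : Set E) :=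
    closure_minimal (Set.image_mono (Submodule.subset_span.trans
      (Submodule.le_topologicalClosure _)))
      (isClosed_image_toWeakSpace_submodule (Submodule.isClosed_topologicalClosure _))
  obtain ⟨c, hc, hSc⟩ : TopologicalSpace.IsSeparable (S : Set E) := by
    rw [Submodule.topologicalClosure_coe]
    exact ((Set.countable_range x).isSeparable.span (R := 𝕜)).closure
  -- Norming functionals at a countable dense set separate the points of `S`; they give a continuous
  -- map to a metrizable space, injective on `K`.
  choose φ hφ hφd using fun d : E => exists_dual_vector'' 𝕜 d
  have hsep : ∀ s ∈ S, (∀ d ∈ c, φ d s = 0) → s = 0 := by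
    intro s hs h
    refine norm_le_zero_iff.1 (le_of_forall_pos_le_add fun ε hε => ?_)
    obtain ⟨d, hd, hsd⟩ := Metric.mem_closure_iff.1 (hSc hs) (ε / 2) (half_pos hε)
    rw [dist_eq_norm] at hsd
    have h1 : ‖d‖ ≤ ‖s - d‖ := by
      have h2 : φ d (s - d) = -(‖d‖ : 𝕜) := by rw [map_sub, h d hd, hφd, zero_sub]
      have h3 := (φ d).le_of_opNorm_le (hφ d) (s - d)
      rw [h2] at h3
      simpa using h3
    have h4 : ‖s‖ ≤ ‖s - d‖ + ‖d‖ := by simpa using norm_add_le (s - d) d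
    linarith
  have := hc.to_subtype
  let Φ : WeakSpace 𝕜 E → (c → 𝕜) := fun y d => φ d ((toWeakSpace 𝕜 E).symm y)
  have hΦ : Continuous Φ := continuous_pi fun d => continuous_eval_weakSpace (φ d)
  have hxK (n : ℕ) : toWeakSpace 𝕜 E (x n) ∈ K := subset_closure ⟨_, ⟨n, rfl⟩, rfl⟩
  obtain ⟨_, ⟨x₀, hx₀, rfl⟩, σ, hσ, hlim⟩ :=
    (IsCompact.image hK hΦ).tendsto_subseq (x := fun n => Φ (toWeakSpace 𝕜 E (x n)))
      fun n => ⟨_, hxK n, rfl⟩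
  have hconv : Tendsto (fun n => toWeakSpace 𝕜 E (x (σ n))) atTop (𝓝 x₀) := by
    refine IsCompact.le_nhds_of_unique_clusterPt hK
      (mem_map.2 (Eventually.of_forall fun n => hxK _)) fun y hy hyc => ?_
    have hΦy : Φ y = Φ x₀ :=
      (MapClusterPt.continuousAt_comp (u := fun n => toWeakSpace 𝕜 E (x (σ n)))
        hΦ.continuousAt hyc).eq_of_tendsto hlim
    obtain ⟨y, hyS, rfl⟩ := hKS hy
    obtain ⟨x₀, hxS, rfl⟩ := hKS hx₀
    have hyx : y - x₀ = 0 := hsep _ (S.sub_mem hyS hxS) fun d hd => by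
      rw [map_sub, sub_eq_zero]
      exact congrFun hΦy ⟨d, hd⟩
    rw [sub_eq_zero.1 hyx]
  refine ⟨(toWeakSpace 𝕜 E).symm x₀, σ, hσ, weaklyNull_iff.2 fun f => ?_⟩
  have := (((continuous_eval_weakSpace f).tendsto x₀).comp hconv).sub_const
    (f ((toWeakSpace 𝕜 E).symm x₀))
  rw [sub_self] at this
  refine this.congr fun n => ?_
  simp

end WeakCompactness

/-! ### Gantmacher's theorem and 1 → 2 -/

section Operators

variable {𝕜 : Type*} [RCLike 𝕜]
  {E : Type*} [NormedAddCommGroup E] [NormedSpace 𝕜 E]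
  {F : Type*} [NormedAddCommGroup F] [NormedSpace 𝕜 F]

/-- The image of the dual unit ball under the adjoint of an operator. -/
def adjointBall (T : E →L[𝕜] F) : Set (StrongDual 𝕜 E) :=
  (fun g : StrongDual 𝕜 F => g.comp T) '' Metric.closedBall 0 1

theorem isBounded_adjointBall (T : E →L[𝕜] F) : Bornology.IsBounded (adjointBall T) := by
  refine isBounded_iff_forall_norm_le.2 ⟨‖T‖, ?_⟩
  rintro _ ⟨g, hg, rfl⟩
  refine (g.opNorm_comp_le T).trans ?_
  exact mul_le_of_le_one_left (norm_nonneg _) (by simpa using hg)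

theorem isBounded_image_closedBall (T : E →L[𝕜] F) :
    Bornology.IsBounded (T '' Metric.closedBall 0 1) :=
  T.lipschitz.isBounded_image Metric.isBounded_closedBall

/-- **Gantmacher's theorem**. -/
theorem isWeaklyCompactOp_iff_relWeaklyCompact_adjointBall [CompleteSpace F] {T : E →L[𝕜] F} :
    IsWeaklyCompactOp T ↔ RelWeaklyCompact 𝕜 (adjointBall T) := by
  constructor
  · intro h
    exact IteratedLimitsAgree.relWeaklyCompact_dual (iteratedLimitsAgree_image_iff.2
      (iteratedLimitsAgree_image_iff.1 h.iteratedLimitsAgree).flip) (isBounded_adjointBall T)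
  · intro h
    have h1 : IteratedLimitsAgree (Metric.closedBall (0 : E) 1)
        (Metric.closedBall (0 : StrongDual 𝕜 F) 1) fun x g => g (T x) := by
      intro a b ha hb
      -- The hypothesis concerns the whole bidual ball; only canonical images of points of `E` are
      -- needed.
      refine (iteratedLimitsAgree_image_iff.1 h.iteratedLimitsAgree).flip
        (fun n => NormedSpace.inclusionInDoubleDual 𝕜 E (a n)) b (fun n => ?_) hb
      have := NormedSpace.double_dual_bound 𝕜 E (a n)
      exact mem_closedBall_zero_iff.2 (this.trans (mem_closedBall_zero_iff.1 (ha n)))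
    exact (iteratedLimitsAgree_image_iff.2 h1).relWeaklyCompact (isBounded_image_closedBall T)

/-- Write `‖T (x n)‖ = (g n ∘ T) (x n)` with `g n` norming. Along a subsequence `g n ∘ T - f₀` is
weakly null, hence uniformly small on the Dunford-Pettis set, while `f₀ (x n) → 0`. -/
theorem IsWeaklyCompactOp.isDPcc [CompleteSpace F] {T : E →L[𝕜] F} (hT : IsWeaklyCompactOp T) :
    IsDPcc T := by
  intro x hx hDP
  refine tendsto_of_subseq_tendsto fun ns hns => ?_
  choose g hg hgx using fun n => exists_dual_vector'' 𝕜 (T (x (ns n)))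
  obtain ⟨f₀, σ, hσ, hnull⟩ :=
    (isWeaklyCompactOp_iff_relWeaklyCompact_adjointBall.1 hT).exists_subseq_weaklyNull
      (x := fun n => (g n).comp T) fun n => ⟨g n, by simpa using hg n, rfl⟩
  refine ⟨σ, tendsto_zero_iff_norm_tendsto_zero.2 ?_⟩
  have h1 : Tendsto (fun n => ((g (σ n)).comp T - f₀) (x (ns (σ n)))) atTop (𝓝 0) := by
    refine Metric.tendsto_nhds.2 fun ε hε => ?_
    filter_upwards [Metric.tendstoUniformlyOn_iff.1 (hDP.2 _ hnull) ε hε] with n hn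
    rw [dist_comm]
    exact hn _ ⟨_, rfl⟩
  have h2 : Tendsto (fun n => f₀ (x (ns (σ n)))) atTop (𝓝 0) :=
    (weaklyNull_iff.1 hx f₀).comp (hns.comp hσ.tendsto_atTop)
  have h3 := (h1.add h2).norm
  rw [add_zero, norm_zero] at h3
  refine h3.congr fun n => ?_
  simp [hgx]

theorem IsDPcc.isLDPSet_adjointBall {T : E →L[𝕜] F} (hT : IsDPcc T) :
    IsLDPSet 𝕜 (adjointBall T) := by
  refine ⟨isBounded_adjointBall T, fun x hx hDP => Metric.tendstoUniformlyOn_iff.2 fun ε hε => ?_⟩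
  filter_upwards [Metric.tendsto_nhds.1 (hT x hx hDP) ε hε] with n hn
  rintro _ ⟨g, hg, rfl⟩
  rw [dist_comm]
  rw [dist_zero_right] at hn ⊢
  exact ((g.le_of_opNorm_le (mem_closedBall_zero_iff.1 hg) _).trans (by simp)).trans_lt hn

theorem W_le_DPcc [CompleteSpace F] : W 𝕜 E F ≤ DPcc 𝕜 E F := fun _ hT =>
  IsWeaklyCompactOp.isDPcc hT

theorem HasLDPProperty.W_eq_DPcc [CompleteSpace F] (h : HasLDPProperty 𝕜 E) :
    W 𝕜 E F = DPcc 𝕜 E F :=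
  le_antisymm W_le_DPcc fun _ hT =>
    isWeaklyCompactOp_iff_relWeaklyCompact_adjointBall.2 (h _ (IsDPcc.isLDPSet_adjointBall hT))

theorem complementedIn_refl (p : Submodule 𝕜 E) : ComplementedIn p p := by
  refine ⟨le_rfl, ?_⟩
  rw [Submodule.submoduleOf_self]
  exact Submodule.closedComplemented_top

end Operators

/-! ### An uncountable almost disjoint family of subsets of ℕ -/

section AlmostDisjoint

/-- The set of codes of the finite initial segments of a binary sequence. -/
def branch (t : ℕ → Bool) : Set ℕ :=
  Set.range fun n => Encodable.encode ((List.range n).map t)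

theorem infinite_branch (t : ℕ → Bool) : (branch t).Infinite := by
  refine Set.infinite_range_of_injective fun m n h => ?_
  simpa using congrArg List.length (Encodable.encode_injective h)

/-- A common code is a common prefix, which cannot extend past a position `k` where `s` and `t`
differ. -/
theorem finite_branch_inter {s t : ℕ → Bool} (h : s ≠ t) : (branch s ∩ branch t).Finite := by
  obtain ⟨k, hk⟩ := Function.ne_iff.1 h
  refine ((Set.finite_Iic k).image
    fun n => Encodable.encode ((List.range n).map s)).subset ?_
  rintro _ ⟨⟨m, rfl⟩, n, hn⟩
  refine ⟨m, ?_, rfl⟩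
  have h1 := Encodable.encode_injective hn
  obtain rfl : n = m := by simpa using congrArg List.length h1
  by_contra hkn
  have hkn : k < n := not_le.1 hkn
  refine hk ?_
  have := List.map_inj_left.1 h1 k (List.mem_range.2 hkn)
  exact this.symm

end AlmostDisjoint

/-! ### Functionals on `ℓ^∞` that vanish on finitely supported sequences -/

section EllInfty

variable {𝕜 : Type*} [RCLike 𝕜]

variable (𝕜) in
/-- The indicator sequence of a set of natural numbers, as an element of `ℓ^∞`. -/
noncomputable def indicatorSeq (M : Set ℕ) : EllInfty 𝕜 :=
  ⟨M.indicator 1, memℓp_infty ⟨1, by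
    classical
    rintro _ ⟨n, rfl⟩
    by_cases h : n ∈ M <;> simp [h]⟩⟩

@[simp]
theorem indicatorSeq_apply (M : Set ℕ) (n : ℕ) :
    indicatorSeq 𝕜 M n = M.indicator (1 : ℕ → 𝕜) n :=
  rfl

theorem apply_indicatorSeq_eq_zero {ψ : StrongDual 𝕜 (EllInfty 𝕜)}
    (hψ : ∀ n, ψ (indicatorSeq 𝕜 {n}) = 0) {D : Set ℕ} (hD : D.Finite) :
    ψ (indicatorSeq 𝕜 D) = 0 := by
  classical
  have : indicatorSeq 𝕜 D = ∑ n ∈ hD.toFinset, indicatorSeq 𝕜 {n} := by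
    ext k
    rw [lp.coeFn_sum]
    simp [Set.indicator_apply]
  simp [this, hψ]

/-- Removing the finite set `D` of pairwise overlaps makes `N` branches disjoint without changing
`ψ`. A unimodular combination of their indicators then has norm at most 1 and value at least `N *
δ`, so `N ≤ ‖ψ‖ / δ`. -/
theorem finite_setOf_lt_norm_apply_branch {ψ : StrongDual 𝕜 (EllInfty 𝕜)}
    (hψ : ∀ n, ψ (indicatorSeq 𝕜 {n}) = 0) {δ : ℝ} (hδ : 0 < δ) :
    {t | δ < ‖ψ (indicatorSeq 𝕜 (branch t))‖}.Finite := by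
  classical
  by_contra hinf
  obtain ⟨N, hN⟩ := exists_nat_gt (‖ψ‖ / δ)
  obtain ⟨S, hS, hcard⟩ := Set.Infinite.exists_subset_card_eq hinf N
  let D : Set ℕ := ⋃ s ∈ S, ⋃ t ∈ S, ⋃ _ : s ≠ t, branch s ∩ branch t
  have hD : D.Finite := S.finite_toSet.biUnion fun s _ => S.finite_toSet.biUnion fun t _ =>
    Set.finite_iUnion fun h => finite_branch_inter h
  choose c hc hcψ using fun t =>
    RCLike.exists_norm_eq_mul_self (ψ (indicatorSeq 𝕜 (branch t)))
  have hdiff (t) : ψ (indicatorSeq 𝕜 (branch t \ D)) = ψ (indicatorSeq 𝕜 (branch t)) := by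
    have : indicatorSeq 𝕜 (branch t) =
        indicatorSeq 𝕜 (branch t \ D) + indicatorSeq 𝕜 (branch t ∩ D) := by
      ext k
      rw [lp.coeFn_add]
      by_cases h1 : k ∈ branch t <;> by_cases h2 : k ∈ D <;> simp [h1, h2]
    rw [this, map_add, apply_indicatorSeq_eq_zero hψ (hD.inter_of_right _), add_zero]
  let y : EllInfty 𝕜 := ∑ t ∈ S, c t • indicatorSeq 𝕜 (branch t \ D)
  have hy : ‖y‖ ≤ 1 := by
    refine lp.norm_le_of_forall_le zero_le_one fun k => ?_
    have hyk : y k = ∑ t ∈ S, c t * (branch t \ D).indicator (1 : ℕ → 𝕜) k := by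
      simp only [y, lp.coeFn_sum, Finset.sum_apply, lp.coeFn_smul, Pi.smul_apply, smul_eq_mul,
        indicatorSeq_apply]
    rw [hyk]
    by_cases hex : ∃ t ∈ S, k ∈ branch t \ D
    · obtain ⟨t, ht, hkt⟩ := hex
      rw [Finset.sum_eq_single_of_mem t ht]
      · simp [hkt, hc]
      · intro s hs hst
        have : k ∉ branch s \ D := fun hks => hkt.2 (by
          simp only [D, Set.mem_iUnion]
          exact ⟨s, hs, t, ht, hst, hks.1, hkt.1⟩)
        simp only [Set.indicator_of_notMem this, mul_zero]
    · push Not at hex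
      rw [Finset.sum_eq_zero fun t ht => by
        rw [Set.indicator_of_notMem (hex t ht), mul_zero]]
      simp
  have hψy : ψ y = ((∑ t ∈ S, ‖ψ (indicatorSeq 𝕜 (branch t))‖ : ℝ) : 𝕜) := by
    simp only [y, map_sum, map_smul, smul_eq_mul, hdiff, hcψ]
  have h1 : ‖ψ y‖ ≤ ‖ψ‖ := ψ.unit_le_opNorm y hy
  have h2 : N * δ ≤ ‖ψ y‖ := by
    rw [hψy, RCLike.norm_ofReal]
    refine le_trans ?_ (le_abs_self _)
    rw [← hcard, ← nsmul_eq_mul]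
    exact Finset.card_nsmul_le_sum _ _ _ fun t ht => (hS ht).le
  rw [div_lt_iff₀ hδ] at hN
  linarith

/-- Countably many functionals on `ℓ^∞` vanishing on finitely supported sequences simultaneously
vanish on the indicator of some infinite set. -/
theorem exists_infinite_forall_apply_indicatorSeq_eq_zero {ι : Type*} [Countable ι]
    (ψ : ι → StrongDual 𝕜 (EllInfty 𝕜)) (hψ : ∀ i n, ψ i (indicatorSeq 𝕜 {n}) = 0) :
    ∃ M : Set ℕ, M.Infinite ∧ ∀ i, ψ i (indicatorSeq 𝕜 M) = 0 := by
  by_contra! h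
  have hcover : (Set.univ : Set (ℕ → Bool)) ⊆
      ⋃ p : ι × ℕ, {t | 1 / ((p.2 : ℝ) + 1) < ‖ψ p.1 (indicatorSeq 𝕜 (branch t))‖} := by
    intro t _
    obtain ⟨i, hi⟩ := h _ (infinite_branch t)
    obtain ⟨n, hn⟩ := exists_nat_one_div_lt (norm_pos_iff.2 hi)
    exact Set.mem_iUnion.2 ⟨(i, n), hn⟩
  have hcount : (Set.univ : Set (ℕ → Bool)).Countable :=
    (Set.countable_iUnion fun p : ι × ℕ => (finite_setOf_lt_norm_apply_branch (hψ p.1)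
      Nat.one_div_pos_of_nat).countable).mono hcover
  have := Set.countable_univ_iff.1 hcount
  obtain ⟨g, hg⟩ := exists_surjective_nat (ℕ → Bool)
  obtain ⟨k, hk⟩ := hg fun n => !(g n n)
  simpa using congrFun hk k

end EllInfty

/-! ### Multiplier operators and 3 → 1 -/

section Multiplier

variable {𝕜 : Type*} [RCLike 𝕜] {E : Type*} [NormedAddCommGroup E] [NormedSpace 𝕜 E]

/-- The operator `x ↦ (f n x)ₙ` into `ℓ^∞` given by a bounded sequence of functionals. -/
noncomputable def seqOp (f : ℕ → StrongDual 𝕜 E) (C : ℝ) (hf : ∀ n, ‖f n‖ ≤ C) :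
    E →L[𝕜] EllInfty 𝕜 :=
  LinearMap.mkContinuous
    { toFun := fun x => ⟨fun n => f n x, memℓp_infty ⟨C * ‖x‖, by
        rintro _ ⟨n, rfl⟩
        exact (f n).le_of_opNorm_le (hf n) x⟩⟩
      map_add' := fun x y => by ext n; exact map_add (f n) x y
      map_smul' := fun c x => by ext n; exact map_smul (f n) c x } C
    fun x => lp.norm_le_of_forall_le
      (mul_nonneg ((norm_nonneg _).trans (hf 0)) (norm_nonneg x))
      fun n => (f n).le_of_opNorm_le (hf n) x

@[simp]
theorem seqOp_apply (f : ℕ → StrongDual 𝕜 E) (C : ℝ) (hf : ∀ n, ‖f n‖ ≤ C) (x : E) (n : ℕ) :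
    seqOp f C hf x n = f n x :=
  rfl

/-- The operators `x ↦ (b n * T x n)ₙ`, depending linearly on the multiplier `b`. -/
noncomputable def multiplier (T : E →L[𝕜] EllInfty 𝕜) :
    EllInfty 𝕜 →L[𝕜] E →L[𝕜] EllInfty 𝕜 :=
  ((ContinuousLinearMap.compL 𝕜 E (EllInfty 𝕜) (EllInfty 𝕜)).flip T).comp
    (ContinuousLinearMap.mul 𝕜 (EllInfty 𝕜))

@[simp]
theorem multiplier_apply (T : E →L[𝕜] EllInfty 𝕜) (b : EllInfty 𝕜) (x : E) :
    multiplier T b x = b * T x :=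
  rfl

theorem isDPcc_multiplier {T : E →L[𝕜] EllInfty 𝕜} (hT : IsDPcc T) (b : EllInfty 𝕜) :
    IsDPcc (multiplier T b) := by
  intro x hx hDP
  simpa using (hT x hx hDP).const_mul b

theorem isDPcc_seqOp {f : ℕ → StrongDual 𝕜 E} {C : ℝ} (hf : ∀ n, ‖f n‖ ≤ C)
    {A : Set (StrongDual 𝕜 E)} (hA : IsLDPSet 𝕜 A) (hfA : ∀ n, f n ∈ A) :
    IsDPcc (seqOp f C hf) := by
  intro x hx hDP
  refine Metric.tendsto_nhds.2 fun ε hε => ?_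
  filter_upwards [Metric.tendstoUniformlyOn_iff.1 (hA.2 x hx hDP) (ε / 2) (half_pos hε)] with n hn
  rw [dist_zero_right]
  refine (lp.norm_le_of_forall_le (half_pos hε).le fun k => ?_).trans_lt (half_lt_self hε)
  have := (hn _ (hfA k)).le
  rwa [dist_comm, dist_zero_right] at this

theorem isWeaklyCompactOp_multiplier_singleton (T : E →L[𝕜] EllInfty 𝕜) (n : ℕ) :
    IsWeaklyCompactOp (multiplier T (indicatorSeq 𝕜 {n})) := by
  have hcont : Continuous fun c : 𝕜 =>
      toWeakSpaceCLM 𝕜 (EllInfty 𝕜) (c • indicatorSeq 𝕜 {n}) :=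
    (toWeakSpaceCLM 𝕜 (EllInfty 𝕜)).continuous.comp (continuous_id.smul continuous_const)
  refine isWeaklyCompactOp_of_subset
    ((isCompact_closedBall (0 : 𝕜) ‖T‖).image hcont) fun x hx => ⟨T x n, ?_, ?_⟩
  · rw [mem_closedBall_zero_iff]
    exact (lp.norm_apply_le_norm ENNReal.top_ne_zero _ n).trans
      (T.unit_le_opNorm x (mem_closedBall_zero_iff.1 hx))
  · refine congrArg (toWeakSpace 𝕜 (EllInfty 𝕜)) ?_
    ext k
    rcases eq_or_ne k n with rfl | hk
    · simp [lp.infty_coeFn_mul]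
    · simp [lp.infty_coeFn_mul, hk]

theorem norm_evalCLM_le (n : ℕ) : ‖lp.evalCLM 𝕜 (fun _ : ℕ => 𝕜) ∞ n‖ ≤ 1 :=
  LinearMap.mkContinuous_norm_le _ zero_le_one _

/-- If `T` maps `x m` to `f n (x m)` for `n` in an infinite set, and `T` is weakly compact, then
the iterated limits of `f n (x m)` coincide. -/
theorem IsWeaklyCompactOp.iteratedLimits_eq {T : E →L[𝕜] EllInfty 𝕜} (hT : IsWeaklyCompactOp T)
    {f : ℕ → StrongDual 𝕜 E} {x : ℕ → E} (hx : ∀ m, x m ∈ Metric.closedBall (0 : E) 1)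
    {M : Set ℕ} (hM : M.Infinite) (hfT : ∀ n ∈ M, ∀ m, T (x m) n = f n (x m))
    {u v : ℕ → 𝕜} {r s : 𝕜}
    (hu : ∀ n, Tendsto (fun m => f n (x m)) atTop (𝓝 (u n))) (hr : Tendsto u atTop (𝓝 r))
    (hv : ∀ m, Tendsto (fun n => f n (x m)) atTop (𝓝 (v m))) (hs : Tendsto v atTop (𝓝 s)) :
    r = s := by
  have hσ : StrictMono (Nat.nth (· ∈ M)) := Nat.nth_strictMono hM
  have hσM (n : ℕ) : Nat.nth (· ∈ M) n ∈ M := Nat.nth_mem_of_infinite hM n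
  have key := (iteratedLimitsAgree_image_iff.1 hT.iteratedLimitsAgree) x
    (fun n => lp.evalCLM 𝕜 (fun _ : ℕ => 𝕜) ∞ (Nat.nth (· ∈ M) n)) hx
    (fun n => mem_closedBall_zero_iff.2 (norm_evalCLM_le _)) v
    (fun n => u (Nat.nth (· ∈ M) n)) s r
  have heval (n m : ℕ) : lp.evalCLM 𝕜 (fun _ : ℕ => 𝕜) ∞ (Nat.nth (· ∈ M) n) (T (x m)) =
      f (Nat.nth (· ∈ M) n) (x m) := hfT _ (hσM n) m
  simp only [heval] at key
  exact (key (fun m => (hv m).comp hσ.tendsto_atTop) hs (fun n => hu _)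
    (hr.comp hσ.tendsto_atTop)).symm

theorem HasLDPProperty.of_complementedIn
    (h : ComplementedIn (W 𝕜 E (EllInfty 𝕜)) (DPcc 𝕜 E (EllInfty 𝕜))) : HasLDPProperty 𝕜 E := by
  intro A hA
  refine IteratedLimitsAgree.relWeaklyCompact_dual ?_ hA.1
  intro f x hf hx u v r s hu hr hv hs
  obtain ⟨-, P, hP⟩ := h
  obtain ⟨C, hC⟩ := isBounded_iff_forall_norm_le.1 hA.1
  let T : E →L[𝕜] EllInfty 𝕜 := seqOp f C fun n => hC _ (hf n)
  have hT : IsDPcc T := isDPcc_seqOp _ hA hf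
  let B : EllInfty 𝕜 →L[𝕜] DPcc 𝕜 E (EllInfty 𝕜) :=
    (multiplier T).codRestrict _ fun b => isDPcc_multiplier hT b
  let Q : EllInfty 𝕜 →L[𝕜] E →L[𝕜] EllInfty 𝕜 :=
    (DPcc 𝕜 E (EllInfty 𝕜)).subtypeL.comp
      (B - (Submodule.subtypeL _).comp (P.comp B))
  have hQ (b : EllInfty 𝕜) : Q b = multiplier T b - ((P (B b) : DPcc 𝕜 E (EllInfty 𝕜)) : _) := rfl
  -- Only the coordinates `n` at the points `x m` matter for the double limits, so countably many
  -- functionals suffice even if `E` is not separable.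
  let ψ : ℕ × ℕ → StrongDual 𝕜 (EllInfty 𝕜) := fun p =>
    (lp.evalCLM 𝕜 (fun _ : ℕ => 𝕜) ∞ p.2).comp (Q.flip (x p.1))
  have hψ (p : ℕ × ℕ) (b : EllInfty 𝕜) : ψ p b = Q b (x p.1) p.2 := rfl
  obtain ⟨M, hM, hψM⟩ := exists_infinite_forall_apply_indicatorSeq_eq_zero ψ fun p n => by
    have hW : B (indicatorSeq 𝕜 {n}) ∈
        (W 𝕜 E (EllInfty 𝕜)).submoduleOf (DPcc 𝕜 E (EllInfty 𝕜)) :=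
      isWeaklyCompactOp_multiplier_singleton T n
    have hPB := hP ⟨_, hW⟩
    have hQ0 : Q (indicatorSeq 𝕜 {n}) = 0 := by
      rw [hQ, hPB]
      exact sub_self (multiplier T (indicatorSeq 𝕜 {n}))
    rw [hψ, hQ0]
    rfl
  have hR : IsWeaklyCompactOp
      ((P (B (indicatorSeq 𝕜 M)) : DPcc 𝕜 E (EllInfty 𝕜)) : E →L[𝕜] EllInfty 𝕜) :=
    (P (B (indicatorSeq 𝕜 M))).2
  refine hR.iteratedLimits_eq hx hM (fun n hn m => ?_) hu hr hv hs
  have h0 := hψM (m, n)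
  rw [hψ, hQ] at h0
  have h1 : multiplier T (indicatorSeq 𝕜 M) (x m) n = f n (x m) := by
    rw [multiplier_apply, lp.infty_coeFn_mul]
    simp [hn, T]
  rw [← h1]
  exact (sub_eq_zero.1 h0).symm

end Multiplier

end LDP

theorem mainTheorem3 {𝕜 : Type*} [RCLike 𝕜]
    {X : Type*} [NormedAddCommGroup X] [NormedSpace 𝕜 X] [CompleteSpace X] :
    List.TFAE
      [LDP.HasLDPProperty 𝕜 X,
        LDP.W 𝕜 X (LDP.EllInfty 𝕜) = LDP.DPcc 𝕜 X (LDP.EllInfty 𝕜),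
        LDP.ComplementedIn (LDP.W 𝕜 X (LDP.EllInfty 𝕜)) (LDP.DPcc 𝕜 X (LDP.EllInfty 𝕜))] := by
  tfae_have 1 → 2 := fun h => h.W_eq_DPcc
  tfae_have 2 → 3 := fun h => h ▸ LDP.complementedIn_refl _
  tfae_have 3 → 1 := LDP.HasLDPProperty.of_complementedIn
  tfae_finish
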